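/- Let $\mathfrak k$ be a field, let $q\in\mathfrak k^*$ with $q^2\neq 1$, and put $[j]_q=\dfrac{q^j-q^{-j}}{q-q^{-1}}$, $[m]_q!=[1]_q[2]_q\cdots[m]_q$. Let $B_{M+1}$ be the braid group with Artin generators $\sigma_1,\dots,\sigma_M$. The Hecke algebra $H_{M+1}(q)$ is the quotient of the group ring $\mathfrak kB_{M+1}$ by the relations $\sigma_i^2=(q-q^{-1})\sigma_i+1$ for $i=1,\dots,M$. For $\nu\in\mathfrak k\setminus\{0,q,-q^{-1}\}$, the Birman–Murakami–Wenzl algebra $BMW_{M+1}(q,\nu)$ is the quotient of $\mathfrak kB_{M+1}$ by the relations $\kappa_i\sigma_i=\sigma_i\kappa_i=\nu\kappa_i$ for $1\le i\le M$ and $\kappa_i\sigma_{i-1}\kappa_i=\nu^{-1}\kappa_i$, $\kappa_i\sigma_{i-1}^{-1}\kappa_i=\nu\kappa_i$ for $2\le i\le M$, where $\kappa_i$ is defined by $\sigma_i-\sigma_i^{-1}=(q-q^{-1})(1-\kappa_i)$. The baxterized elements are $$\sigma_i(x)=\frac{x\sigma_i-x^{-1}\sigma_i^{-1}}{q-q^{-1}}\quad\text{(Hecke)},\qquad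 \sigma_i(x)=x^{-1}\Bigl(1+\frac{x^2-1}{q-q^{-1}}\,\sigma_i+\frac{x^2-1}{1-\nu^{-1}q^{-1}x^2}\,\kappa_i\Bigr)\quad\text{(BMW)}.$$ For $0\le n\le M$ let ${}^q\mathrm{Sh}_{1,n}=\sigma_1(q)\sigma_2(q^2)\cdots\sigma_n(q^n)$ be the highest multiplicative $1$-shuffle (equal to $1$ for $n=0$). A symmetrizer $S_{n+1}$ in either algebra is a non-zero idempotent of the subalgebra generated by $\sigma_1^{\pm1},\dots,\sigma_n^{\pm1}$ such that $\sigma_iS_{n+1}=S_{n+1}\sigma_i=qS_{n+1}$ for $i=1,\dots,n$. Let $0\le n\le M$ and suppose $[n+1]_q!\neq0$; in the BMW case suppose also that $1-\nu^{-1}q^{-1}q^{2j}\neq 0$ for $j=1,\dots,n$, so that the baxterized elements $\sigma_j(q^j)$ are defined. Then, in $H_{M+1}(q)$ and in $BMW_{M+1}(q,\nu)$ alike (in particular for $M=n$), there is exactly one symmetrizer $S_{n+1}$, and it is given by $$S_{n+1}=\Bigl(\frac{1}{[n+1]_q!}\;{}^q\mathrm{Sh}_{1,n}\Bigr)^n.$$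 -/

import Mathlib

namespace BraidShuffle

/-- Relators of the braid group `B_{M+1}` in the Artin presentation. The generator
`σ_{i+1}` of the usual numbering is the one with (zero-based) index `i : Fin M`. -/
def braidRels (M : ℕ) : Set (FreeGroup (Fin M)) :=
  {r | ∃ i j : Fin M, i.val + 1 = j.val ∧
      r = (FreeGroup.of i * FreeGroup.of j * FreeGroup.of i) *
        (FreeGroup.of j * FreeGroup.of i * FreeGroup.of j)⁻¹} ∪
  {r | ∃ i j : Fin M, i.val + 1 < j.val ∧
      r = (FreeGroup.of i * FreeGroup.of j) * (FreeGroup.of j * FreeGroup.of i)⁻¹}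

/-- The braid group `B_{M+1}` on `M + 1` strands. -/
abbrev Braid (M : ℕ) : Type := PresentedGroup (braidRels M)

/-- The group ring `k B_{M+1}`. -/
abbrev BraidRing (k : Type*) [Field k] (M : ℕ) := MonoidAlgebra k (Braid M)

/-- The Artin generators as units of the group ring `k B_{M+1}`. -/
noncomputable def braidGen (k : Type*) [Field k] {M : ℕ} (i : Fin M) : (BraidRing k M)ˣ :=
  Units.map (MonoidAlgebra.of k (Braid M)) (toUnits (PresentedGroup.of i))

/-- The defining relations `σ_i² = (q - q⁻¹) σ_i + 1` of the Hecke algebra. -/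
inductive HeckeRel {k : Type*} [Field k] (M : ℕ) (q : k) :
    BraidRing k M → BraidRing k M → Prop
  | quad (i : Fin M) : HeckeRel M q ((braidGen k i : BraidRing k M) ^ 2)
      ((q - q⁻¹) • (braidGen k i : BraidRing k M) + 1)

/-- The Hecke algebra `H_{M+1}(q)` of type A, a quotient of the braid group ring. -/
abbrev Hecke {k : Type*} [Field k] (M : ℕ) (q : k) := RingQuot (HeckeRel M q)

/-- The generators `σ_1, …, σ_M` of `H_{M+1}(q)`, as units. -/
noncomputable def heckeGen {k : Type*} [Field k] (M : ℕ) (q : k) (i : Fin M) :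
    (Hecke M q)ˣ :=
  Units.map (RingQuot.mkAlgHom k (HeckeRel M q)).toMonoidHom (braidGen k i)

/-- The element `κ` attached to an invertible element `σ`, i.e. the solution (for `q² ≠ 1`) of
`σ - σ⁻¹ = (q - q⁻¹) (1 - κ)`. -/
noncomputable def kappa {k A : Type*} [Field k] [Ring A] [Algebra k A] (q : k) (g : Aˣ) : A :=
  1 - (q - q⁻¹)⁻¹ • ((g : A) - ((g⁻¹ : Aˣ) : A))

/-- The defining relations of the Birman–Murakami–Wenzl algebra. -/
inductive BMWRel {k : Type*} [Field k] (M : ℕ) (q ν : k) :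
    BraidRing k M → BraidRing k M → Prop
  | kappa_sigma (i : Fin M) : BMWRel M q ν
      (kappa q (braidGen k i) * (braidGen k i : BraidRing k M))
      (ν • kappa q (braidGen k i))
  | sigma_kappa (i : Fin M) : BMWRel M q ν
      ((braidGen k i : BraidRing k M) * kappa q (braidGen k i))
      (ν • kappa q (braidGen k i))
  | kappa_sigma_kappa (i j : Fin M) (h : j.val + 1 = i.val) : BMWRel M q ν
      (kappa q (braidGen k i) * (braidGen k j : BraidRing k M) * kappa q (braidGen k i))
      (ν⁻¹ • kappa q (braidGen k i))
  | kappa_sigma_inv_kappa (i j : Fin M) (h : j.val + 1 = i.val) : BMWRel M q ν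
      (kappa q (braidGen k i) * (((braidGen k j)⁻¹ : (BraidRing k M)ˣ) : BraidRing k M) *
        kappa q (braidGen k i))
      (ν • kappa q (braidGen k i))

/-- The Birman–Murakami–Wenzl algebra `BMW_{M+1}(q, ν)`, a quotient of the braid group ring. -/
abbrev BMW {k : Type*} [Field k] (M : ℕ) (q ν : k) := RingQuot (BMWRel M q ν)

/-- The generators `σ_1, …, σ_M` of `BMW_{M+1}(q, ν)`, as units. -/
noncomputable def bmwGen {k : Type*} [Field k] (M : ℕ) (q ν : k) (i : Fin M) :
    (BMW M q ν)ˣ :=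
  Units.map (RingQuot.mkAlgHom k (BMWRel M q ν)).toMonoidHom (braidGen k i)

/-- `S` is a symmetrizer `S_n`, with respect to the generators `σ_1, σ_2, …`: a non-zero
idempotent of the subalgebra generated by `σ_1^{±1}, …, σ_{n-1}^{±1}` with
`σ_i S = S σ_i = q S` for `1 ≤ i ≤ n - 1`. -/
structure IsSymmetrizer {k A : Type*} [Field k] [Ring A] [Algebra k A] {M : ℕ}
    (q : k) (g : Fin M → Aˣ) (n : ℕ) (S : A) : Prop where
  mem : S ∈ Algebra.adjoin k
    {x : A | ∃ i : Fin M, i.val + 1 < n ∧ (x = (g i : A) ∨ x = ((g i)⁻¹ : Aˣ))}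
  ne_zero : S ≠ 0
  left_eq : ∀ i : Fin M, i.val + 1 < n → (g i : A) * S = q • S
  right_eq : ∀ i : Fin M, i.val + 1 < n → S * (g i : A) = q • S
  idem : S ^ 2 = S

/-- The `q`-number `[n]_q = (q^n - q^{-n}) / (q - q⁻¹)`. -/
noncomputable def qInt {k : Type*} [Field k] (q : k) (n : ℕ) : k :=
  (q ^ n - (q ^ n)⁻¹) / (q - q⁻¹)

/-- The `q`-factorial `[n]_q! = [1]_q [2]_q ⋯ [n]_q`. -/
noncomputable def qFactorial {k : Type*} [Field k] (q : k) (n : ℕ) : k :=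
  ∏ j ∈ Finset.range n, qInt q (j + 1)

/-- The Hecke baxterized element `σ(x) = (x σ - x⁻¹ σ⁻¹) / (q - q⁻¹)`. -/
noncomputable def heckeBax {k A : Type*} [Field k] [Ring A] [Algebra k A]
    (q : k) (g : Aˣ) (x : k) : A :=
  (q - q⁻¹)⁻¹ • (x • (g : A) - x⁻¹ • ((g⁻¹ : Aˣ) : A))

/-- The BMW baxterized element
`σ(x) = x⁻¹ (1 + (x² - 1) / (q - q⁻¹) σ + (x² - 1) / (1 - ν⁻¹ q⁻¹ x²) κ)`. -/
noncomputable def bmwBax {k A : Type*} [Field k] [Ring A] [Algebra k A]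
    (q ν : k) (g : Aˣ) (x : k) : A :=
  x⁻¹ • (1 + ((x ^ 2 - 1) / (q - q⁻¹)) • (g : A) +
    ((x ^ 2 - 1) / (1 - ν⁻¹ * q⁻¹ * x ^ 2)) • kappa q g)

/-- The highest multiplicative 1-shuffle `σ_1(q) σ_2(q²) ⋯ σ_n(q^n)` (in this order), for
generators `σ_1, …, σ_M` (`n ≤ M`) and a baxterization `bax σ x = σ(x)`. -/
def oneShuffle {k A : Type*} [Field k] [Ring A] {M : ℕ} (bax : Aˣ → k → A)
    (g : Fin M → Aˣ) (q : k) (n : ℕ) (h : n ≤ M) : A :=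
  (List.ofFn fun i : Fin n => bax (g (Fin.castLE h i)) (q ^ (i.val + 1))).prod

end BraidShuffle

/-!
Write `g_0, g_1, …` for the generators, `b_i = σ_{i+1}(q^{i+1})`, and `P = b_0 b_1 ⋯ b_{n-1}` for
the shuffle.

*Existence of a left eigenvector.* By locality and a form of the Yang–Baxter equation
(`bmwBax_step`, `heckeBax_step`), if `g_i Y = q Y` then `g_{i+1} b_i b_{i+1} Y = q b_i b_{i+1} Y`.
Since `g_0 b_0 = q b_0`, it follows that `P Y` is a `q`-eigenvector of `g_0`, and of `g_i` as soon
as `Y` is one of `g_{i-1}` (`IsShuffleFamily.gen_mul_partialShuffle_mul`). Hence every application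
of `P` gains one more generator, and `g_i P^n = q P^n` for all `i < n`.

*Two-sidedness.* The defining relations are invariant under reversal of words, so the same argument
in the opposite algebra shows that the reversed product `P'` satisfies `P'^n g_i = q P'^n`. The
character `χ` with `χ(g_i) = q` exists on both algebras and takes the value `[n+1]_q!` on `P` and
`P'`. The subalgebra of the first `n` generators acts through `χ` on eigenvectors, so the
normalized powers `X`, `X'` satisfy `X = X' X = X'`. Therefore `X` is a two-sided eigenvector,
idempotent because `χ(X) = 1`, and non-zero for the same reason.

*Uniqueness.* A symmetrizer `S` is a non-zero idempotent with `S² = χ(S) S`, hence `χ(S) = 1`, and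
then `S = S X = X` (`isSymmetrizer_iff_of_character`).
-/

namespace BraidShuffle

variable {k A : Type*} [Field k] [Ring A] [Algebra k A]

/-! ### Eigenvectors and the local relations of baxterized elements -/

/-- The quadratic relation of the BMW generators, with its correction term in `κ`. -/
theorem kappa_mul_self_unit {q : k} (hl : q - q⁻¹ ≠ 0) {g : Aˣ} {ν : k}
    (h : kappa q g * (g : A) = ν • kappa q g) :
    (g : A) * g = 1 + (q - q⁻¹) • (g : A) - ((q - q⁻¹) * ν) • kappa q g := by
  rw [mul_smul, ← h]
  simp only [kappa, sub_mul, smul_mul_assoc, one_mul, smul_sub, smul_smul, mul_inv_cancel₀ hl,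
    one_smul, Units.inv_mul]
  abel

theorem inv_mul_of_eigen {q : k} (hq : q ≠ 0) {g : Aˣ} {Y : A} (h : (g : A) * Y = q • Y) :
    ((g⁻¹ : Aˣ) : A) * Y = q⁻¹ • Y := by
  rw [Units.inv_mul_eq_iff_eq_mul, mul_smul_comm, h, smul_smul, inv_mul_cancel₀ hq, one_smul]

/-- Conjugation by `t s` carries `t` to `s`, hence also carries `κ_t` to `κ_s`. -/
theorem braid_mul_kappa {q : k} {s t : Aˣ} (hb : s * t * s = t * s * t) :
    (t : A) * s * kappa q t = kappa q s * t * s := by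
  have h1 : (t : A) * s * t = s * t * s := by exact_mod_cast congrArg Units.val hb.symm
  have h2 : (t : A) * s * ((t⁻¹ : Aˣ) : A) = ((s⁻¹ : Aˣ) : A) * t * s := by
    have : t * s * t⁻¹ = s⁻¹ * t * s := by
      rw [mul_inv_eq_iff_eq_mul, mul_assoc, mul_assoc, eq_inv_mul_iff_mul_eq, ← mul_assoc,
        ← mul_assoc, hb]
    exact_mod_cast congrArg Units.val this
  simp only [kappa, mul_sub, sub_mul, mul_one, one_mul, mul_smul_comm, smul_mul_assoc, h1, h2]

/-- The tangle relation `κ_s κ_t = t s κ_t`: write `κ_s` as a conjugate of `κ_t` and use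
`κ_t s⁻¹ κ_t = ν κ_t`. -/
theorem kappa_mul_kappa {q ν : k} (hν : ν ≠ 0) {s t : Aˣ} (hb : s * t * s = t * s * t)
    (hσκ : (t : A) * kappa q t = ν • kappa q t)
    (hκσκ : kappa q t * ((s⁻¹ : Aˣ) : A) * kappa q t = ν • kappa q t) :
    kappa q s * kappa q t = t * s * kappa q t := by
  have h3 : kappa q s = (t : A) * s * kappa q t * ((s⁻¹ : Aˣ) : A) * ((t⁻¹ : Aˣ) : A) := by
    rw [braid_mul_kappa hb]; simp [mul_assoc]
  rw [h3, mul_assoc _ _ (kappa q t), inv_mul_of_eigen hν hσκ, mul_smul_comm,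
    mul_assoc _ _ (kappa q t), mul_assoc _ (kappa q t), ← mul_assoc (kappa q t), hκσκ,
    mul_smul_comm, smul_smul, inv_mul_cancel₀ hν, one_smul]

/-- If `Y` is a `q`-eigenvector of `s`, then `s(x) t(qx) Y` is a `q`-eigenvector of `t`.

For generic `ν` this reflects the Yang–Baxter equation
`t(q⁻¹) s(x) t(qx) = s(qx) t(x) s(q⁻¹)` applied to `Y`. The parameter `ν = q⁻³`, for which
`t(q⁻¹)` has a vanishing denominator, is allowed here, so the identity is instead checked
by expanding both sides in `Y`, `tY`, `κ_t Y`, `s t Y`, `s κ_t Y`, `κ_s κ_t Y`. -/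
theorem bmwBax_step {q ν : k} (hq : q ≠ 0) (hl : q - q⁻¹ ≠ 0) (hν : ν ≠ 0) {s t : Aˣ}
    (hb : s * t * s = t * s * t)
    (hκσ : kappa q t * (t : A) = ν • kappa q t)
    (hσκ : (t : A) * kappa q t = ν • kappa q t)
    (h1 : kappa q t * (s : A) * kappa q t = ν⁻¹ • kappa q t)
    (h2 : kappa q t * ((s⁻¹ : Aˣ) : A) * kappa q t = ν • kappa q t)
    {x : k} (hx : x ≠ 0) (hd : 1 - ν⁻¹ * q⁻¹ * x ^ 2 ≠ 0)
    (hd' : 1 - ν⁻¹ * q⁻¹ * (q * x) ^ 2 ≠ 0)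
    {Y : A} (hY : (s : A) * Y = q • Y) :
    (t : A) * (bmwBax q ν s x * bmwBax q ν t (q * x) * Y) =
      q • (bmwBax q ν s x * bmwBax q ν t (q * x) * Y) := by
  have hκY : kappa q s * Y = 0 := by
    rw [kappa, sub_mul, smul_mul_assoc, sub_mul, hY, inv_mul_of_eigen hq hY, ← sub_smul,
      smul_smul, inv_mul_cancel₀ hl, one_mul, one_smul, sub_self]
  have hbA : (t : A) * s * t = s * t * s := by exact_mod_cast congrArg Units.val hb.symm
  -- `F0` to `F6` reduce the products that arise to the six spanning vectors; `F4` serves `F6`.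
  have F0 (Z : A) : (t : A) * (t * Z) = Z + (q - q⁻¹) • ((t : A) * Z)
      - ((q - q⁻¹) * ν) • (kappa q t * Z) := by
    rw [← mul_assoc, kappa_mul_self_unit hl hκσ]
    simp only [sub_mul, add_mul, one_mul, smul_mul_assoc]
  have F1 : (t : A) * (s * (t * Y)) = q • ((s : A) * (t * Y)) := by
    rw [← mul_assoc, ← mul_assoc, hbA, mul_assoc, hY, mul_smul_comm, mul_assoc]
  have F2 : (t : A) * (s * (kappa q t * Y)) = kappa q s * (kappa q t * Y) := by
    rw [← mul_assoc (kappa q s), kappa_mul_kappa hν hb hσκ h2]; simp only [mul_assoc]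
  have F3 : kappa q s * (t * Y) = q⁻¹ • (kappa q s * (kappa q t * Y)) := by
    rw [← F2, eq_inv_smul_iff₀ hq, ← mul_smul_comm, ← mul_smul_comm, ← hY]
    simpa only [mul_assoc] using (congrArg (· * Y) (braid_mul_kappa (q := q) hb)).symm
  have F4 : kappa q t * (s * (kappa q t * Y)) = ν⁻¹ • (kappa q t * Y) := by
    rw [← mul_assoc, ← mul_assoc, h1, smul_mul_assoc]
  have F5 : (t : A) * (kappa q t * Y) = ν • (kappa q t * Y) := by
    rw [← mul_assoc, hσκ, smul_mul_assoc]
  have F6 : (t : A) * (kappa q s * (kappa q t * Y)) = (s : A) * (kappa q t * Y)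
      + (q - q⁻¹) • (kappa q s * (kappa q t * Y)) - (q - q⁻¹) • (kappa q t * Y) := by
    rw [← F2, F0, F4, smul_smul, mul_assoc, mul_inv_cancel₀ hν, mul_one]
  -- The denominators are brought to polynomial form for `field_simp`.
  have hl' : q ^ 2 - 1 ≠ 0 := by
    intro h; apply hl; field_simp; linear_combination h
  have e1 : q * ν - x ^ 2 ≠ 0 := by
    intro h; apply hd; field_simp; linear_combination h
  have e2 : ν - q * x ^ 2 ≠ 0 := by
    intro h; apply hd'; field_simp; linear_combination h
  have r0 : q - q⁻¹ = (q ^ 2 - 1) / q := by field_simp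
  have r1 : 1 - ν⁻¹ * q⁻¹ * x ^ 2 = (q * ν - x ^ 2) / (q * ν) := by field_simp
  have r2 : 1 - ν⁻¹ * q⁻¹ * (q * x) ^ 2 = (ν - q * x ^ 2) / ν := by field_simp
  simp only [bmwBax, r1, r2]
  simp only [smul_mul_assoc, mul_smul_comm, add_mul, mul_add, one_mul, mul_one,
    mul_zero, mul_assoc, hY, hκY, F0, F1, F2, F3, F5, F6]
  rw [r0]
  match_scalars <;> field_simp <;> ring

/-- When `[2]_q ≠ 0`, the element `σ(q) / [2]_q` is the projector onto the `q`-eigenspace of `σ`; this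
relation holds for every `[2]_q`. -/
theorem bmwBax_self {q ν : k} (hq : q ≠ 0) (hl : q - q⁻¹ ≠ 0) (hν : ν ≠ 0) {t : Aˣ}
    (hκσ : kappa q t * (t : A) = ν • kappa q t)
    (hσκ : (t : A) * kappa q t = ν • kappa q t)
    (hd : 1 - ν⁻¹ * q⁻¹ * q ^ 2 ≠ 0) :
    (t : A) * bmwBax q ν t q = q • bmwBax q ν t q := by
  simp only [bmwBax, mul_smul_comm, mul_add, mul_one, hσκ, kappa_mul_self_unit hl hκσ]
  have hl' : q ^ 2 - 1 ≠ 0 := by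
    intro h; apply hl; field_simp; linear_combination h
  have e1 : ν - q ≠ 0 := by
    intro h; apply hd; field_simp; linear_combination h
  have r0 : q - q⁻¹ = (q ^ 2 - 1) / q := by field_simp
  have r1 : 1 - ν⁻¹ * q⁻¹ * q ^ 2 = (ν - q) / ν := by field_simp
  rw [r0, r1]
  match_scalars <;> field_simp <;> ring

theorem heckeBax_eq {q : k} (hq : q ≠ 0) (hl : q - q⁻¹ ≠ 0) {g : Aˣ}
    (h : (g : A) ^ 2 = (q - q⁻¹) • (g : A) + 1) {x : k} (hx : x ≠ 0) :
    heckeBax q g x = x⁻¹ • (1 + ((x ^ 2 - 1) / (q - q⁻¹)) • (g : A)) := by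
  have hi : ((g⁻¹ : Aˣ) : A) = g - (q - q⁻¹) • 1 := by
    rw [Units.inv_eq_of_mul_eq_one_right]
    rw [mul_sub, ← sq, h, mul_smul_comm, mul_one]; abel
  rw [heckeBax, hi]
  have hl' : q ^ 2 - 1 ≠ 0 := by
    intro h; apply hl; field_simp; linear_combination h
  have r0 : q - q⁻¹ = (q ^ 2 - 1) / q := by field_simp
  rw [r0]
  match_scalars <;> field_simp

/-- The Hecke counterpart of `bmwBax_step`. -/
theorem heckeBax_step {q : k} (hq : q ≠ 0) (hl : q - q⁻¹ ≠ 0) {s t : Aˣ}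
    (hb : s * t * s = t * s * t)
    (hs : (s : A) ^ 2 = (q - q⁻¹) • (s : A) + 1)
    (ht : (t : A) ^ 2 = (q - q⁻¹) • (t : A) + 1)
    {x : k} (hx : x ≠ 0) {Y : A} (hY : (s : A) * Y = q • Y) :
    (t : A) * (heckeBax q s x * heckeBax q t (q * x) * Y) =
      q • (heckeBax q s x * heckeBax q t (q * x) * Y) := by
  have hbA : (t : A) * s * t = s * t * s := by exact_mod_cast congrArg Units.val hb.symm
  have F0 : (t : A) * (t * Y) = (q - q⁻¹) • ((t : A) * Y) + Y := by
    rw [← mul_assoc, ← sq, ht, add_mul, one_mul, smul_mul_assoc]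
  have F1 : (t : A) * (s * (t * Y)) = q • ((s : A) * (t * Y)) := by
    rw [← mul_assoc, ← mul_assoc, hbA, mul_assoc, hY, mul_smul_comm, mul_assoc]
  rw [heckeBax_eq hq hl hs hx, heckeBax_eq hq hl ht (mul_ne_zero hq hx)]
  simp only [smul_mul_assoc, mul_smul_comm, add_mul, mul_add, one_mul, mul_one, mul_assoc,
    hY, F0, F1]
  have hl' : q ^ 2 - 1 ≠ 0 := by
    intro h; apply hl; field_simp; linear_combination h
  have r0 : q - q⁻¹ = (q ^ 2 - 1) / q := by field_simp
  rw [r0]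
  match_scalars <;> field_simp <;> ring

theorem heckeBax_self {q : k} (hq : q ≠ 0) (hl : q - q⁻¹ ≠ 0) {t : Aˣ}
    (ht : (t : A) ^ 2 = (q - q⁻¹) • (t : A) + 1) :
    (t : A) * heckeBax q t q = q • heckeBax q t q := by
  rw [heckeBax_eq hq hl ht hq]
  simp only [mul_smul_comm, mul_add, mul_one, ← sq, ht]
  have hl' : q ^ 2 - 1 ≠ 0 := by
    intro h; apply hl; field_simp; linear_combination h
  have r0 : q - q⁻¹ = (q ^ 2 - 1) / q := by field_simp
  rw [r0]
  match_scalars <;> field_simp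
  ring

/-! ### Powers of the shuffle -/

/-- The ordered product `b_0 b_1 ⋯ b_{m-1}` of the first `m` members of a family. For
`b_i = σ_{i+1}(q^{i+1})` it is definitionally `oneShuffle`. -/
def partialShuffle {M : ℕ} (b : Fin M → A) (m : ℕ) (h : m ≤ M) : A :=
  (List.ofFn fun i : Fin m => b (Fin.castLE h i)).prod

theorem partialShuffle_succ {M : ℕ} (b : Fin M → A) (m : ℕ) (h : m + 1 ≤ M) :
    partialShuffle b (m + 1) h = partialShuffle b m (Nat.le_of_succ_le h) * b ⟨m, h⟩ := by
  rw [partialShuffle, List.ofFn_succ', List.concat_eq_append, List.prod_append, List.prod_singleton]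
  rfl

/-- The properties of the baxterized elements `b_i = σ_{i+1}(q^{i+1})`, `i < n`, on which the
shuffle argument rests: locality, the image of `b_0` consisting of `q`-eigenvectors of `g_0`, and
the passage from `q`-eigenvectors of `g_i` to those of `g_{i+1}` by means of `b_i b_{i+1}`. -/
structure IsShuffleFamily {M : ℕ} (q : k) (n : ℕ) (g : Fin M → Aˣ) (b : Fin M → A) : Prop where
  comm_lt : ∀ i j : Fin M, i.val + 1 < j.val → Commute (g i : A) (b j)
  comm_gt : ∀ i j : Fin M, i.val + 1 < j.val → Commute (g j : A) (b i)
  first : ∀ i : Fin M, i.val = 0 → i.val < n → (g i : A) * b i = q • b i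
  step : ∀ i j : Fin M, i.val + 1 = j.val → j.val < n → ∀ Y : A, (g i : A) * Y = q • Y →
    (g j : A) * (b i * b j * Y) = q • (b i * b j * Y)

namespace IsShuffleFamily
variable {M n : ℕ} {q : k} {g : Fin M → Aˣ} {b : Fin M → A}

theorem commute_partialShuffle (hb : IsShuffleFamily q n g b) (j : Fin M) :
    ∀ (m : ℕ) (hm : m ≤ M), m < j.val → Commute (g j : A) (partialShuffle b m hm)
  | 0, _, _ => by simp [partialShuffle]
  | m + 1, hm, h => by
    rw [partialShuffle_succ]
    exact (hb.commute_partialShuffle j m _ (by omega)).mul_right (hb.comm_gt ⟨m, hm⟩ j h)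

/-- The shuffle turns `q`-eigenvectors of `g_{i-1}` into `q`-eigenvectors of `g_i`; for `i = 0` the
hypothesis on `Y` is empty. -/
theorem gen_mul_partialShuffle_mul (hb : IsShuffleFamily q n g b) (i : Fin M) :
    ∀ (m : ℕ) (hm : m ≤ M), m ≤ n → i.val < m → ∀ Y : A,
      (∀ j : Fin M, j.val + 1 = i.val → (g j : A) * Y = q • Y) →
      (g i : A) * (partialShuffle b m hm * Y) = q • (partialShuffle b m hm * Y)
  | 0, _, _, h => absurd h (by omega)
  | m + 1, hm, hmn, h => fun Y hY => by
    rcases Nat.lt_succ_iff_lt_or_eq.mp h with hi | hi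
    -- The last factor is far from `g_{i-1}`, so it preserves the eigenvector property.
    · rw [partialShuffle_succ, mul_assoc]
      refine hb.gen_mul_partialShuffle_mul i m _ (by omega) hi _ fun j hj => ?_
      rw [← mul_assoc, (hb.comm_lt j ⟨m, hm⟩ (by simp only; omega)).eq, mul_assoc, hY j hj,
        mul_smul_comm]
    · obtain rfl : i = ⟨m, hm⟩ := Fin.ext hi
      -- `g_m` commutes with all factors before the last two, where `step` applies.
      rcases m with _ | m
      · rw [partialShuffle_succ, partialShuffle]
        simp only [List.ofFn_zero, List.prod_nil, one_mul]
        rw [← mul_assoc, hb.first _ rfl (by simp only; omega), smul_mul_assoc]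
      · rw [partialShuffle_succ, partialShuffle_succ, mul_assoc, mul_assoc, ← mul_assoc (b _),
          ← mul_assoc, (hb.commute_partialShuffle _ m _ (by simp)).eq, mul_assoc,
          hb.step ⟨m, by omega⟩ ⟨m + 1, hm⟩ rfl (by simp only; omega) Y (hY _ rfl), mul_smul_comm]

/-- Each further factor of the shuffle adds one more generator that acts by `q`. -/
theorem gen_mul_partialShuffle_pow (hb : IsShuffleFamily q n g b) (hn : n ≤ M) :
    ∀ (r : ℕ) (i : Fin M), i.val < r → i.val < n →
      (g i : A) * partialShuffle b n hn ^ r = q • partialShuffle b n hn ^ r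
  | 0, _, h, _ => absurd h (by omega)
  | r + 1, i, h, hi => by
    rw [pow_succ']
    exact hb.gen_mul_partialShuffle_mul i n hn le_rfl hi _ fun j hj =>
      hb.gen_mul_partialShuffle_pow hn r j (by omega) (by omega)

end IsShuffleFamily

/-! ### Opposite algebra -/

/-- A unit of `A`, regarded as a unit of the opposite algebra. -/
def opUnit (u : Aˣ) : (Aᵐᵒᵖ)ˣ := Units.opEquiv.symm (MulOpposite.op u)

theorem val_opUnit (u : Aˣ) : (opUnit u : Aᵐᵒᵖ) = MulOpposite.op (u : A) := rfl

theorem val_inv_opUnit (u : Aˣ) :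
    (((opUnit u)⁻¹ : (Aᵐᵒᵖ)ˣ) : Aᵐᵒᵖ) = MulOpposite.op ((u⁻¹ : Aˣ) : A) := rfl

theorem opUnit_mul (u v : Aˣ) : opUnit u * opUnit v = opUnit (v * u) := rfl

/-! ### Symmetrizers and the character sending every generator to `q` -/

/-- The generators and their inverses that appear in the definition of the symmetrizer `S_n`. -/
abbrev genSet {M : ℕ} (g : Fin M → Aˣ) (n : ℕ) : Set A :=
  {x : A | ∃ i : Fin M, i.val + 1 < n ∧ (x = (g i : A) ∨ x = ((g i)⁻¹ : Aˣ))}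

section Character
variable {M n : ℕ} {q : k} {g : Fin M → Aˣ} {χ : A →ₐ[k] k}

theorem character_inv (hχ : ∀ i, χ (g i) = q) (i : Fin M) : χ ((g i)⁻¹ : Aˣ) = q⁻¹ := by
  rw [← hχ i]
  exact eq_inv_of_mul_eq_one_left (by rw [← map_mul, Units.inv_mul, map_one])

/-- The subalgebra of the first generators acts through `χ` on their common `q`-eigenvectors. -/
theorem mul_eq_character_smul (hq : q ≠ 0) (hχ : ∀ i, χ (g i) = q) {Y : A}
    (hY : ∀ i : Fin M, i.val + 1 < n → (g i : A) * Y = q • Y) {a : A}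
    (ha : a ∈ Algebra.adjoin k (genSet g n)) : a * Y = χ a • Y := by
  induction ha using Algebra.adjoin_induction with
  | mem x hx =>
    obtain ⟨i, hi, rfl | rfl⟩ := hx
    · rw [hY i hi, hχ]
    · rw [inv_mul_of_eigen hq (hY i hi), character_inv hχ]
  | algebraMap r => rw [AlgHom.commutes, Algebra.smul_def, Algebra.algebraMap_self_apply]
  | add x y _ _ hx hy => rw [add_mul, hx, hy, map_add, add_smul]
  | mul x y _ _ hx hy => rw [mul_assoc, hy, mul_smul_comm, hx, map_mul, smul_smul, mul_comm]

/-- The right-handed form of `mul_eq_character_smul`. -/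
theorem mul_eq_character_smul' (hq : q ≠ 0) (hχ : ∀ i, χ (g i) = q) {Y : A}
    (hY : ∀ i : Fin M, i.val + 1 < n → Y * (g i : A) = q • Y) {a : A}
    (ha : a ∈ Algebra.adjoin k (genSet g n)) : Y * a = χ a • Y := by
  induction ha using Algebra.adjoin_induction with
  | mem x hx =>
    obtain ⟨i, hi, rfl | rfl⟩ := hx
    · rw [hY i hi, hχ]
    · rw [Units.mul_inv_eq_iff_eq_mul, smul_mul_assoc, hY i hi, smul_smul, character_inv hχ,
        inv_mul_cancel₀ hq, one_smul]
  | algebraMap r =>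
    rw [AlgHom.commutes, ← Algebra.commutes, Algebra.smul_def, Algebra.algebraMap_self_apply]
  | add x y _ _ hx hy => rw [mul_add, hx, hy, map_add, add_smul]
  | mul x y _ _ hx hy => rw [← mul_assoc, hx, smul_mul_assoc, hy, map_mul, smul_smul]

/-- If `X` is a left and `X'` a right eigenvector, both in the subalgebra and with `χ` equal to `1`,
then `X' X` equals both `X` and `X'`, and `X` is the only symmetrizer. -/
theorem isSymmetrizer_iff_of_character (hq : q ≠ 0) (hχ : ∀ i, χ (g i) = q) {X X' : A}
    (hX : X ∈ Algebra.adjoin k (genSet g n)) (hX' : X' ∈ Algebra.adjoin k (genSet g n))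
    (hχX : χ X = 1) (hχX' : χ X' = 1)
    (hl : ∀ i : Fin M, i.val + 1 < n → (g i : A) * X = q • X)
    (hr : ∀ i : Fin M, i.val + 1 < n → X' * (g i : A) = q • X') (S : A) :
    IsSymmetrizer q g n S ↔ S = X := by
  -- Both sides evaluate the product `X' * X`.
  have hXX : X = X' := by
    have h1 := mul_eq_character_smul hq hχ hl hX'
    rw [mul_eq_character_smul' hq hχ hr hX, hχX, hχX', one_smul, one_smul] at h1
    exact h1.symm
  constructor
  -- `S` and `X` are two-sided eigenvectors with `χ = 1`, so `S * X` equals both of them.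
  · intro hS
    have h1 : χ S = 1 := by
      have h2 := mul_eq_character_smul hq hχ hS.left_eq hS.mem
      rw [← sq, hS.idem] at h2
      have h3 : (1 - χ S) • S = 0 := by rw [sub_smul, one_smul, ← h2, sub_self]
      exact (sub_eq_zero.mp ((smul_eq_zero.mp h3).resolve_right hS.ne_zero)).symm
    have h2 := mul_eq_character_smul hq hχ hl hS.mem
    rw [mul_eq_character_smul' hq hχ hS.right_eq hX, h1, hχX, one_smul, one_smul] at h2
    exact h2
  · rintro rfl
    refine ⟨hX, ?_, hl, by rwa [hXX], ?_⟩
    · rintro rfl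
      simp at hχX
    · rw [sq, mul_eq_character_smul hq hχ hl hX, hχX, one_smul]

theorem qFactorial_succ_eq_prod (hl : q - q⁻¹ ≠ 0) (n : ℕ) :
    qFactorial q (n + 1) = ∏ i : Fin n, qInt q (i.val + 2) := by
  rw [qFactorial, Finset.prod_range_succ', Finset.prod_range]
  simp [qInt, div_self hl]

/-- The shuffle power is the only symmetrizer, given the shuffle properties in `A` and in `Aᵐᵒᵖ`.
The latter provide a right eigenvector, namely the power of the reversed product. -/
theorem isSymmetrizer_iff_partialShuffle_pow (hq : q ≠ 0) (hl : q - q⁻¹ ≠ 0)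
    (hχ : ∀ i, χ (g i) = q) {b : Fin M → A}
    (hb : IsShuffleFamily q n g b)
    (hb' : IsShuffleFamily q n (fun i => opUnit (g i)) fun i => MulOpposite.op (b i))
    (hχb : ∀ i : Fin M, i.val < n → χ (b i) = qInt q (i.val + 2))
    (hmem : ∀ i : Fin M, b i ∈ Algebra.adjoin k {(g i : A), (((g i)⁻¹ : Aˣ) : A)})
    (hn : n ≤ M) (hfact : qFactorial q (n + 1) ≠ 0) (S : A) :
    IsSymmetrizer q g (n + 1) S ↔
      S = ((1 / qFactorial q (n + 1)) • partialShuffle b n hn) ^ n := by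
  have hmem' (i : Fin n) : b (Fin.castLE hn i) ∈ Algebra.adjoin k (genSet g (n + 1)) := by
    refine Algebra.adjoin_mono ?_ (hmem _)
    rintro x (rfl | rfl)
    exacts [⟨_, by simp, Or.inl rfl⟩, ⟨_, by simp, Or.inr rfl⟩]
  have hχP : (List.ofFn fun i : Fin n => χ (b (Fin.castLE hn i))).prod = qFactorial q (n + 1) := by
    rw [List.prod_ofFn, qFactorial_succ_eq_prod hl]
    exact Finset.prod_congr rfl fun i _ => hχb _ (by simp)
  refine isSymmetrizer_iff_of_character hq hχ
    (X' := ((1 / qFactorial q (n + 1)) •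
      (List.ofFn fun i : Fin n => b (Fin.castLE hn i)).reverse.prod) ^ n) ?_ ?_ ?_ ?_ ?_ ?_ S
  · refine pow_mem (Subalgebra.smul_mem _ (Subalgebra.list_prod_mem _ fun x hx => ?_) _) _
    obtain ⟨i, rfl⟩ := List.mem_ofFn.mp hx
    exact hmem' i
  · refine pow_mem (Subalgebra.smul_mem _ (Subalgebra.list_prod_mem _ fun x hx => ?_) _) _
    obtain ⟨i, rfl⟩ := List.mem_ofFn.mp (List.mem_reverse.mp hx)
    exact hmem' i
  · rw [map_pow, map_smul, partialShuffle, map_list_prod, List.map_ofFn]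
    simp only [Function.comp_def, hχP, smul_eq_mul, one_div, inv_mul_cancel₀ hfact, one_pow]
  · rw [map_pow, map_smul, map_list_prod, List.map_reverse, List.prod_reverse, List.map_ofFn]
    simp only [Function.comp_def, hχP, smul_eq_mul, one_div, inv_mul_cancel₀ hfact, one_pow]
  · intro i hi
    rw [smul_pow, mul_smul_comm,
      hb.gen_mul_partialShuffle_pow hn n i (by omega) (by omega), smul_comm]
  · intro i hi
    have h := congrArg MulOpposite.unop
      (hb'.gen_mul_partialShuffle_pow hn n i (by omega) (by omega))
    simp only [partialShuffle, MulOpposite.unop_mul, MulOpposite.unop_pow, MulOpposite.unop_smul,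
      MulOpposite.unop_list_prod, List.map_ofFn, Function.comp_def, MulOpposite.unop_op,
      val_opUnit] at h
    rw [smul_pow, smul_mul_assoc, h, smul_comm]

end Character

/-! ### Families satisfying the braid, Hecke and BMW relations -/

/-- A family of units satisfying the Artin relations. -/
structure IsBraidFamily {M : ℕ} (g : Fin M → Aˣ) : Prop where
  braid : ∀ i j : Fin M, i.val + 1 = j.val → g i * g j * g i = g j * g i * g j
  comm : ∀ i j : Fin M, i.val + 1 < j.val → Commute (g i) (g j)

/-- The Artin relations are invariant under reversal of words. -/
theorem IsBraidFamily.op {M : ℕ} {g : Fin M → Aˣ} (h : IsBraidFamily g) :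
    IsBraidFamily fun i => opUnit (g i) where
  braid i j hij := by simp only [opUnit_mul, ← mul_assoc, h.braid i j hij]
  comm i j hij := by
    rw [Commute, SemiconjBy, opUnit_mul, opUnit_mul, (h.comm i j hij).eq]

/-- A family of units satisfying the defining relations of the Hecke algebra. -/
structure IsHeckeFamily {M : ℕ} (q : k) (g : Fin M → Aˣ) : Prop extends IsBraidFamily g where
  quad : ∀ i, (g i : A) ^ 2 = (q - q⁻¹) • (g i : A) + 1

theorem IsHeckeFamily.op {M : ℕ} {q : k} {g : Fin M → Aˣ} (h : IsHeckeFamily q g) :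
    IsHeckeFamily q fun i => opUnit (g i) where
  toIsBraidFamily := h.toIsBraidFamily.op
  quad i := by
    rw [val_opUnit, ← MulOpposite.op_pow, h.quad]; rfl

/-- A family of units satisfying the defining relations of the BMW algebra. -/
structure IsBMWFamily {M : ℕ} (q ν : k) (g : Fin M → Aˣ) : Prop extends IsBraidFamily g where
  kappa_sigma : ∀ i, kappa q (g i) * (g i : A) = ν • kappa q (g i)
  sigma_kappa : ∀ i, (g i : A) * kappa q (g i) = ν • kappa q (g i)
  kappa_sigma_kappa : ∀ i j : Fin M, j.val + 1 = i.val →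
    kappa q (g i) * (g j : A) * kappa q (g i) = ν⁻¹ • kappa q (g i)
  kappa_sigma_inv_kappa : ∀ i j : Fin M, j.val + 1 = i.val →
    kappa q (g i) * (((g j)⁻¹ : Aˣ) : A) * kappa q (g i) = ν • kappa q (g i)

theorem kappa_opUnit (q : k) (u : Aˣ) : kappa q (opUnit u) = MulOpposite.op (kappa q u) := rfl

theorem IsBMWFamily.op {M : ℕ} {q ν : k} {g : Fin M → Aˣ} (h : IsBMWFamily q ν g) :
    IsBMWFamily q ν fun i => opUnit (g i) where
  toIsBraidFamily := h.toIsBraidFamily.op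
  kappa_sigma i := by
    rw [kappa_opUnit, val_opUnit, ← MulOpposite.op_mul, h.sigma_kappa, MulOpposite.op_smul]
  sigma_kappa i := by
    rw [kappa_opUnit, val_opUnit, ← MulOpposite.op_mul, h.kappa_sigma, MulOpposite.op_smul]
  kappa_sigma_kappa i j hij := by
    rw [kappa_opUnit, val_opUnit, ← MulOpposite.op_mul, ← MulOpposite.op_mul, ← mul_assoc,
      h.kappa_sigma_kappa i j hij, MulOpposite.op_smul]
  kappa_sigma_inv_kappa i j hij := by
    rw [kappa_opUnit, val_inv_opUnit, ← MulOpposite.op_mul, ← MulOpposite.op_mul, ← mul_assoc,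
      h.kappa_sigma_inv_kappa i j hij, MulOpposite.op_smul]

theorem heckeBax_mem (q : k) (u : Aˣ) (x : k) :
    heckeBax q u x ∈ Algebra.adjoin k {(u : A), ((u⁻¹ : Aˣ) : A)} := by
  have h1 : (u : A) ∈ Algebra.adjoin k {(u : A), ((u⁻¹ : Aˣ) : A)} :=
    Algebra.subset_adjoin (by simp)
  have h2 : ((u⁻¹ : Aˣ) : A) ∈ Algebra.adjoin k {(u : A), ((u⁻¹ : Aˣ) : A)} :=
    Algebra.subset_adjoin (by simp)
  exact Subalgebra.smul_mem _ (sub_mem (Subalgebra.smul_mem _ h1 _) (Subalgebra.smul_mem _ h2 _)) _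

theorem bmwBax_mem (q ν : k) (u : Aˣ) (x : k) :
    bmwBax q ν u x ∈ Algebra.adjoin k {(u : A), ((u⁻¹ : Aˣ) : A)} := by
  have h1 : (u : A) ∈ Algebra.adjoin k {(u : A), ((u⁻¹ : Aˣ) : A)} :=
    Algebra.subset_adjoin (by simp)
  have h2 : ((u⁻¹ : Aˣ) : A) ∈ Algebra.adjoin k {(u : A), ((u⁻¹ : Aˣ) : A)} :=
    Algebra.subset_adjoin (by simp)
  have h3 : kappa q u ∈ Algebra.adjoin k {(u : A), ((u⁻¹ : Aˣ) : A)} :=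
    sub_mem (one_mem _) (Subalgebra.smul_mem _ (sub_mem h1 h2) _)
  exact Subalgebra.smul_mem _ (add_mem (add_mem (one_mem _) (Subalgebra.smul_mem _ h1 _))
    (Subalgebra.smul_mem _ h3 _)) _

theorem commute_of_mem_adjoin_unit {u v : Aˣ} (h : Commute u v) {a : A}
    (ha : a ∈ Algebra.adjoin k {(v : A), ((v⁻¹ : Aˣ) : A)}) : Commute (u : A) a := by
  induction ha using Algebra.adjoin_induction with
  | mem x hx =>
    rcases hx with rfl | rfl
    · exact h.units_val
    · exact h.inv_right.units_val
  | algebraMap r => exact (Algebra.commutes r _).symm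
  | add x y _ _ hx hy => exact hx.add_right hy
  | mul x y _ _ hx hy => exact hx.mul_right hy

theorem IsHeckeFamily.isShuffleFamily {M : ℕ} {q : k} {g : Fin M → Aˣ} (h : IsHeckeFamily q g)
    (hq : q ≠ 0) (hl : q - q⁻¹ ≠ 0) (n : ℕ) :
    IsShuffleFamily q n g fun i => heckeBax q (g i) (q ^ (i.val + 1)) where
  comm_lt i j hij := commute_of_mem_adjoin_unit (h.comm i j hij) (heckeBax_mem _ _ _)
  comm_gt i j hij := commute_of_mem_adjoin_unit (h.comm i j hij).symm (heckeBax_mem _ _ _)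
  first i hi _ := by
    simpa only [hi, zero_add, pow_one] using heckeBax_self hq hl (h.quad i)
  step i j hij _ Y hY := by
    rw [← hij, pow_succ' q (i.val + 1)]
    exact heckeBax_step hq hl (h.braid i j hij) (h.quad i) (h.quad j) (pow_ne_zero _ hq) hY

theorem IsBMWFamily.isShuffleFamily {M : ℕ} {q ν : k} {g : Fin M → Aˣ} (h : IsBMWFamily q ν g)
    (hq : q ≠ 0) (hl : q - q⁻¹ ≠ 0) (hν : ν ≠ 0) {n : ℕ}
    (hd : ∀ j : ℕ, 1 ≤ j → j ≤ n → 1 - ν⁻¹ * q⁻¹ * (q ^ j) ^ 2 ≠ 0) :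
    IsShuffleFamily q n g fun i => bmwBax q ν (g i) (q ^ (i.val + 1)) where
  comm_lt i j hij := commute_of_mem_adjoin_unit (h.comm i j hij) (bmwBax_mem _ _ _ _)
  comm_gt i j hij := commute_of_mem_adjoin_unit (h.comm i j hij).symm (bmwBax_mem _ _ _ _)
  first i hi hin := by
    have h1 := hd 1 le_rfl (by omega)
    rw [pow_one] at h1
    simpa only [hi, zero_add, pow_one] using
      bmwBax_self hq hl hν (h.kappa_sigma i) (h.sigma_kappa i) h1
  step i j hij hjn Y hY := by
    have h1 := hd (i.val + 1) (by omega) (by omega)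
    have h2 := hd (i.val + 1 + 1) (by omega) (by omega)
    rw [pow_succ' q (i.val + 1)] at h2
    rw [← hij, pow_succ' q (i.val + 1)]
    exact bmwBax_step hq hl hν (h.braid i j hij) (h.kappa_sigma j) (h.sigma_kappa j)
      (h.kappa_sigma_kappa j i hij) (h.kappa_sigma_inv_kappa j i hij) (pow_ne_zero _ hq) h1 h2 hY

theorem map_kappa {B : Type*} [Ring B] [Algebra k B] (f : A →ₐ[k] B) (q : k) (u : Aˣ) :
    f (kappa q u) = kappa q (Units.map (f : A →* B) u) := by
  simp [kappa, ← map_inv]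

theorem map_heckeBax {B : Type*} [Ring B] [Algebra k B] (f : A →ₐ[k] B) (q : k) (u : Aˣ) (x : k) :
    f (heckeBax q u x) = heckeBax q (Units.map (f : A →* B) u) x := by
  simp [heckeBax, ← map_inv]

theorem map_bmwBax {B : Type*} [Ring B] [Algebra k B] (f : A →ₐ[k] B) (q ν : k) (u : Aˣ) (x : k) :
    f (bmwBax q ν u x) = bmwBax q ν (Units.map (f : A →* B) u) x := by
  simp [bmwBax, map_kappa]

theorem kappa_mk0 {q : k} (hq : q ≠ 0) (hl : q - q⁻¹ ≠ 0) : kappa q (Units.mk0 q hq) = 0 := by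
  simp [kappa, inv_mul_cancel₀ hl]

/-- The value of the character `σ ↦ q` on `σ(q^m)`. -/
theorem heckeBax_mk0 {q : k} (hq : q ≠ 0) (m : ℕ) :
    heckeBax q (Units.mk0 q hq) (q ^ m) = qInt q (m + 1) := by
  simp only [heckeBax, qInt, Units.val_mk0, Units.val_inv_eq_inv_val, smul_eq_mul, pow_succ,
    mul_inv]
  rw [div_eq_inv_mul]

/-- The value of the character `σ ↦ q`, under which `κ` vanishes, on `σ(q^m)`. -/
theorem bmwBax_mk0 {q : k} (hq : q ≠ 0) (hl : q - q⁻¹ ≠ 0) (ν : k) (m : ℕ) :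
    bmwBax q ν (Units.mk0 q hq) (q ^ m) = qInt q (m + 1) := by
  have hl' : q ^ 2 - 1 ≠ 0 := by
    intro h; apply hl; field_simp; linear_combination h
  have r0 : q - q⁻¹ = (q ^ 2 - 1) / q := by field_simp
  simp only [bmwBax, kappa_mk0 hq hl, qInt, Units.val_mk0, smul_eq_mul, r0]
  field_simp
  ring

/-! ### The Hecke and BMW algebras -/

theorem isBraidFamily_braidGen (M : ℕ) : IsBraidFamily (braidGen k (M := M)) where
  braid i j hij := by
    have h : (PresentedGroup.of i * PresentedGroup.of j * PresentedGroup.of i : Braid M) =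
        PresentedGroup.of j * PresentedGroup.of i * PresentedGroup.of j := by
      have := PresentedGroup.one_of_mem (rels := braidRels M) (Or.inl ⟨i, j, hij, rfl⟩)
      rw [map_mul, map_inv] at this
      exact mul_inv_eq_one.mp this
    simp only [braidGen, ← map_mul, h]
  comm i j hij := by
    have h : (PresentedGroup.of i * PresentedGroup.of j : Braid M) =
        PresentedGroup.of j * PresentedGroup.of i := by
      have := PresentedGroup.one_of_mem (rels := braidRels M) (Or.inr ⟨i, j, hij, rfl⟩)
      rw [map_mul, map_inv] at this
      exact mul_inv_eq_one.mp this
    simp only [Commute, SemiconjBy, braidGen, ← map_mul, h]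

theorem IsBraidFamily.map {B : Type*} [Ring B] {M : ℕ} {g : Fin M → Aˣ} (h : IsBraidFamily g)
    (f : A →* B) : IsBraidFamily fun i => Units.map f (g i) where
  braid i j hij := by simp only [← map_mul, h.braid i j hij]
  comm i j hij := (h.comm i j hij).map _

theorem isHeckeFamily_heckeGen (M : ℕ) (q : k) : IsHeckeFamily q (heckeGen M q) where
  toIsBraidFamily := (isBraidFamily_braidGen M).map _
  quad i := by
    have h := RingQuot.mkAlgHom_rel k (HeckeRel.quad (q := q) i)
    rw [map_pow, map_add, map_smul, map_one] at h
    exact h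

theorem isBMWFamily_bmwGen (M : ℕ) (q ν : k) : IsBMWFamily q ν (bmwGen M q ν) := by
  have hκ (i : Fin M) : kappa q (bmwGen M q ν i) =
      RingQuot.mkAlgHom k (BMWRel M q ν) (kappa q (braidGen k i)) := (map_kappa _ q _).symm
  refine ⟨(isBraidFamily_braidGen M).map _, fun i => ?_, fun i => ?_, fun i j hij => ?_,
    fun i j hij => ?_⟩ <;> rw [hκ, ← map_smul]
  · exact (map_mul _ _ _).symm.trans (RingQuot.mkAlgHom_rel k (BMWRel.kappa_sigma i))
  · exact (map_mul _ _ _).symm.trans (RingQuot.mkAlgHom_rel k (BMWRel.sigma_kappa i))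
  · rw [← RingQuot.mkAlgHom_rel k (BMWRel.kappa_sigma_kappa i j hij), map_mul, map_mul]; rfl
  · rw [← RingQuot.mkAlgHom_rel k (BMWRel.kappa_sigma_inv_kappa i j hij), map_mul, map_mul]; rfl

/-- The character of the braid group ring sending every Artin generator to `q`. -/
noncomputable def braidCharacter (M : ℕ) {q : k} (hq : q ≠ 0) : BraidRing k M →ₐ[k] k :=
  MonoidAlgebra.lift k k (Braid M) ((Units.coeHom k).comp
    (PresentedGroup.toGroup (f := fun _ => Units.mk0 q hq) (by
      rintro r (⟨i, j, -, rfl⟩ | ⟨i, j, -, rfl⟩) <;> simp)))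

theorem map_braidCharacter_braidGen {M : ℕ} {q : k} (hq : q ≠ 0) (i : Fin M) :
    Units.map (braidCharacter M hq : BraidRing k M →* k) (braidGen k i) = Units.mk0 q hq := by
  ext
  simp [braidCharacter, braidGen]

theorem braidCharacter_braidGen {M : ℕ} {q : k} (hq : q ≠ 0) (i : Fin M) :
    braidCharacter M hq (braidGen k i : BraidRing k M) = q :=
  congrArg Units.val (map_braidCharacter_braidGen hq i)

theorem exists_hecke_character (M : ℕ) {q : k} (hq : q ≠ 0) :
    ∃ χ : Hecke M q →ₐ[k] k, ∀ i, χ (heckeGen M q i) = q := by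
  refine ⟨RingQuot.liftAlgHom k ⟨braidCharacter M hq, ?_⟩, fun i =>
    (RingQuot.liftAlgHom_mkAlgHom_apply _ _ _ _).trans (braidCharacter_braidGen hq i)⟩
  rintro _ _ ⟨i⟩
  simp only [map_pow, map_add, map_smul, map_one, braidCharacter_braidGen, smul_eq_mul]
  field_simp
  ring

theorem exists_bmw_character (M : ℕ) {q : k} (hq : q ≠ 0) (hl : q - q⁻¹ ≠ 0) (ν : k) :
    ∃ χ : BMW M q ν →ₐ[k] k, ∀ i, χ (bmwGen M q ν i) = q := by
  refine ⟨RingQuot.liftAlgHom k ⟨braidCharacter M hq, ?_⟩, fun i =>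
    (RingQuot.liftAlgHom_mkAlgHom_apply _ _ _ _).trans (braidCharacter_braidGen hq i)⟩
  have hκ (i : Fin M) : braidCharacter M hq (kappa q (braidGen k i)) = 0 := by
    rw [map_kappa, map_braidCharacter_braidGen, kappa_mk0 hq hl]
  rintro _ _ (i | i | ⟨i, j, h⟩ | ⟨i, j, h⟩) <;> simp [hκ]

theorem unitsMap_eq_mk0 {q : k} (hq : q ≠ 0) {χ : A →ₐ[k] k} {u : Aˣ} (h : χ u = q) :
    Units.map (χ : A →* k) u = Units.mk0 q hq := Units.ext h

end BraidShuffle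

theorem mainTheorem1 {k : Type*} [Field k] (q : k) (hq : q ≠ 0) (hq2 : q ^ 2 ≠ 1)
    (M n : ℕ) (hn : n ≤ M) (hfact : BraidShuffle.qFactorial q (n + 1) ≠ 0) :
    (∀ S : BraidShuffle.Hecke M q,
      BraidShuffle.IsSymmetrizer q (BraidShuffle.heckeGen M q) (n + 1) S ↔
        S = ((1 / BraidShuffle.qFactorial q (n + 1)) •
          BraidShuffle.oneShuffle (BraidShuffle.heckeBax q)
            (BraidShuffle.heckeGen M q) q n hn) ^ n) ∧
    (∀ ν : k, ν ≠ 0 → ν ≠ q → ν ≠ -q⁻¹ →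
      (∀ j : ℕ, 1 ≤ j → j ≤ n → 1 - ν⁻¹ * q⁻¹ * (q ^ j) ^ 2 ≠ 0) →
      ∀ S : BraidShuffle.BMW M q ν,
        BraidShuffle.IsSymmetrizer q (BraidShuffle.bmwGen M q ν) (n + 1) S ↔
          S = ((1 / BraidShuffle.qFactorial q (n + 1)) •
            BraidShuffle.oneShuffle (BraidShuffle.bmwBax q ν)
              (BraidShuffle.bmwGen M q ν) q n hn) ^ n) := by
  have hl : q - q⁻¹ ≠ 0 := by
    intro h
    apply hq2
    field_simp at h
    linear_combination h
  refine ⟨fun S => ?_, fun ν hν _ _ hd S => ?_⟩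
  · obtain ⟨χ, hχ⟩ := BraidShuffle.exists_hecke_character M hq
    have hg := BraidShuffle.isHeckeFamily_heckeGen M q
    refine BraidShuffle.isSymmetrizer_iff_partialShuffle_pow hq hl hχ
      (hg.isShuffleFamily hq hl n) (hg.op.isShuffleFamily hq hl n) (fun i _ => ?_)
      (fun i => BraidShuffle.heckeBax_mem _ _ _) hn hfact S
    rw [BraidShuffle.map_heckeBax, BraidShuffle.unitsMap_eq_mk0 hq (hχ i),
      BraidShuffle.heckeBax_mk0]
  · obtain ⟨χ, hχ⟩ := BraidShuffle.exists_bmw_character M hq hl ν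
    have hg := BraidShuffle.isBMWFamily_bmwGen M q ν
    refine BraidShuffle.isSymmetrizer_iff_partialShuffle_pow hq hl hχ
      (hg.isShuffleFamily hq hl hν hd) (hg.op.isShuffleFamily hq hl hν hd) (fun i _ => ?_)
      (fun i => BraidShuffle.bmwBax_mem _ _ _ _) hn hfact S
    rw [BraidShuffle.map_bmwBax, BraidShuffle.unitsMap_eq_mk0 hq (hχ i),
      BraidShuffle.bmwBax_mk0 hq hl]
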